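/- Let $K=\mathbb C$ (the same holds for $K=\mathbb R$) and $N\ge 1$. The Monster tower $(\mathcal P^k(N),\Delta_k)_{k\ge 0}$ starts with $\mathcal P^0(N)=K^N$, $\Delta_0=TK^N$; a point of $\mathcal P^{k+1}(N)$ is a pair $(p,\ell)$ with $p\in\mathcal P^k(N)$ and $\ell\subset\Delta_k(p)$ a line, and $\Delta_{k+1}(p,\ell)=d\pi^{-1}(\ell)$, where $\pi:\mathcal P^{k+1}(N)\to\mathcal P^k(N)$ is the projection $(p,\ell)\mapsto p$. The vertical space $V_k(p)$ is the kernel of the differential at $p$ of the projection $\mathcal P^k(N)\to\mathcal P^{k-1}(N)$ ($k\ge1$). For $1\le i\le k$ and $p\in\mathcal P^k(N)$ let $F_i$ be the fibre of $\mathcal P^i(N)\to\mathcal P^{i-1}(N)$ through the projection $p_i$ of $p$ to level $i$. Put $\mathcal P^0(F_i)=F_i$; let $\mathcal P^{j+1}(F_i)\subset\mathcal P^{i+j+1}(N)$ consist of all $(q,\ell)$ with $q\in\mathcal P^j(F_i)$ and $\ell\subset\delta_i^j(q):=\Delta_{i+j}(q)\cap T_q\mathcal P^j(F_i)$. If $p\in\mathcal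 P^{k-i}(F_i)$, then $\delta_i^{k-i}(p)$ is called a critical hyperplane through $p$; for $i=k$ it is $V_k(p)$. The prolongation of a non-constant analytic curve germ $\gamma:(K,0)\to K^N$ is the analytic germ $\gamma^1$ with $\gamma^1(t)=(\gamma(t),\operatorname{span}\gamma'(t))$ for $t\ne0$; iterating, one gets $\gamma^k$ in $\mathcal P^k(N)$. We say that $\gamma^k$ reaches $p$ if $\gamma^k(0)=p$. The embedding dimension of $\gamma$ is the least dimension of a smooth (analytic) submanifold germ containing it, and $\gamma$ is planar if its embedding dimension is at most $2$. A point $p\in\mathcal P^k(N)$ is a planar point if, among the germs $\gamma$ for which $\gamma^k(0)=p$, $\gamma^k$ is immersed at $0$ and its tangent line at $0$ lies in no critical hyperplane, all have embedding dimension at least $2$ and one has embedding dimension $2$. The code of $p\in\mathcal P^k(N)$ is a word of $k$ letters. The $i$-th letter is determined by the line $\ell$ with $p_i=(p_{i-1},\ell)$: it is $L$ if $\ell$ lies in $V_{i-1}(p_{i-1})$ and in another critical hyperplane through $p_{i-1}$; $V$ if $\ell\subset V_{i-1}(p_{i-1})$ otherwise; $T$ if $\ell$ is not vertical but lies in a critical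 hyperplane; $R$ if $\ell$ lies in no critical hyperplane. The class of a word is the set of points with that code. **Theorem.** (1) Let $\zeta=(p,\ell)\in\mathcal P^{k+1}(N)$ be a point for which $\ell$ lies in the intersection of two distinct critical hyperplanes through $p$. Then $\zeta$ is not reached by the $(k+1)$-st prolongation of any planar curve germ. Moreover, no point $q$ of a level $m\ge k+1$ which projects to $\zeta$ is reached by the $m$-th prolongation of a planar curve germ. (2) In particular, if a word contains the letter $L$, then no point of its class, at level $m$ say, is reached by the $m$-th prolongation of a planar curve germ, and no point of the class is a planar point. -/

import Mathlib

open Filter Topology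

/-! The Monster (Semple) tower over `𝕜^(n+1)`, where `𝕜` is `ℂ` (or `ℝ`).

A point of level `k + 1` is a pair `(p, ℓ)` with `p` a point of level `k` and `ℓ` a line in
`Δ_k(p) ⊆ T_p`.  As usual for manifolds, the tangent space at `p`, and germs at `p` of curves and of
submanifolds, are written in a chart around `p`: an affine chart of Kumpera-Ruiz type. -/

namespace Monster

noncomputable section

/-- The affine space on which the charts of level `k` are modelled: `n + 1` base coordinates and,
for each level from `1` to `k`, `n` affine coordinates of the projective space fibre. -/
def Coord (𝕜 : Type*) (n : ℕ) : ℕ → Type _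
  | 0 => Fin (n + 1) → 𝕜
  | k + 1 => Coord 𝕜 n k × (Fin n → 𝕜)

instance Coord.instNormedAddCommGroup {𝕜 : Type*} [RCLike 𝕜] {n : ℕ} :
    (k : ℕ) → NormedAddCommGroup (Coord 𝕜 n k)
  | 0 => inferInstanceAs (NormedAddCommGroup (Fin (n + 1) → 𝕜))
  | k + 1 =>
    letI := Coord.instNormedAddCommGroup (𝕜 := 𝕜) (n := n) k
    inferInstanceAs (NormedAddCommGroup (Coord 𝕜 n k × (Fin n → 𝕜)))

instance Coord.instNormedSpace {𝕜 : Type*} [RCLike 𝕜] {n : ℕ} :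
    (k : ℕ) → NormedSpace 𝕜 (Coord 𝕜 n k)
  | 0 => inferInstanceAs (NormedSpace 𝕜 (Fin (n + 1) → 𝕜))
  | k + 1 =>
    letI := Coord.instNormedSpace (𝕜 := 𝕜) (n := n) k
    inferInstanceAs (NormedSpace 𝕜 (Coord 𝕜 n k × (Fin n → 𝕜)))

/-- The bundle projection from level `k + 1` to level `k`, in charts. It is linear, so it is also
its own differential. -/
def Coord.proj {𝕜 : Type*} [RCLike 𝕜] {n k : ℕ} : Coord 𝕜 n (k + 1) →L[𝕜] Coord 𝕜 n k :=
  ContinuousLinearMap.fst 𝕜 (Coord 𝕜 n k) (Fin n → 𝕜)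

/-- The affine coordinates of the last fibre. -/
def Coord.fib {𝕜 : Type*} [RCLike 𝕜] {n k : ℕ} : Coord 𝕜 n (k + 1) →L[𝕜] (Fin n → 𝕜) :=
  ContinuousLinearMap.snd 𝕜 (Coord 𝕜 n k) (Fin n → 𝕜)

/-- The coordinates of level `k + 1` with given base part and given fibre part. -/
def Coord.mk {𝕜 : Type*} {n k : ℕ} (y : Coord 𝕜 n k) (u : Fin n → 𝕜) : Coord 𝕜 n (k + 1) :=
  (y, u)

/-- A chart of level `k` is a choice, for each level, of one of the `n + 1` standard affine charts
of the projective space of lines. -/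
inductive Chart (n : ℕ) : ℕ → Type
  | base : Chart n 0
  | snoc {k : ℕ} (c : Chart n k) (i : Fin (n + 1)) : Chart n (k + 1)

/-- The vector with homogeneous coordinates `[u_1 : … : 1 : … : u_n]` (the `1` at place `i`) with
respect to the family `e`. -/
def affineVector {𝕜 : Type*} [RCLike 𝕜] {E : Type*} [AddCommMonoid E] [Module 𝕜 E] {n : ℕ}
    (e : Fin (n + 1) → E) (i : Fin (n + 1)) (u : Fin n → 𝕜) : E :=
  ∑ a, (i.insertNth (α := fun _ => 𝕜) 1 u) a • e a

/-- The frame of the distribution in a chart: the standard frame of `𝕜^(n+1)` at level `0`; at level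
`k + 1`, in the `i`-th affine chart, the coordinate fields of the fibre and, at place `i`, the lift of
the vector that spans the line which the point represents. -/
def frame {𝕜 : Type*} [RCLike 𝕜] {n : ℕ} :
    {k : ℕ} → Chart n k → Coord 𝕜 n k → Fin (n + 1) → Coord 𝕜 n k
  | _, .base, _ => fun j => (Pi.single j 1 : Fin (n + 1) → 𝕜)
  | _, .snoc (k := k) c i, x =>
    i.insertNth (α := fun _ => Coord 𝕜 n (k + 1))
      (Coord.mk (affineVector (frame c (Coord.proj x)) i (Coord.fib x)) 0)
      (fun m => Coord.mk 0 (Pi.single m 1))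

/-- The line in the tangent space of level `k` which is represented by the coordinates `x` of level
`k + 1` in the chart `c.snoc i`. -/
def chartLine {𝕜 : Type*} [RCLike 𝕜] {n k : ℕ} (c : Chart n k) (i : Fin (n + 1))
    (x : Coord 𝕜 n (k + 1)) : Submodule 𝕜 (Coord 𝕜 n k) :=
  Submodule.span 𝕜 {affineVector (frame c (Coord.proj x)) i (Coord.fib x)}

/-- The distribution `Δ_k` in a chart: `Δ_0` is the tangent bundle, and `Δ_{k+1}(p, ℓ)` is the
preimage of `ℓ` under the differential of the bundle projection. -/
def chartDelta {𝕜 : Type*} [RCLike 𝕜] {n : ℕ} :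
    {k : ℕ} → Chart n k → Coord 𝕜 n k → Submodule 𝕜 (Coord 𝕜 n k)
  | _, .base, _ => ⊤
  | _, .snoc c i, x => (chartLine c i x).comap (Coord.proj (𝕜 := 𝕜) (n := n)).toLinearMap

/-- The vertical space: the kernel of the differential of the bundle projection; zero at level `0`,
where there is no projection. -/
def chartVertical (𝕜 : Type*) [RCLike 𝕜] (n : ℕ) : (k : ℕ) → Submodule 𝕜 (Coord 𝕜 n k)
  | 0 => ⊥
  | _ + 1 => LinearMap.ker (Coord.proj (𝕜 := 𝕜) (n := n)).toLinearMap

theorem span_frame {𝕜 : Type*} [RCLike 𝕜] {n k : ℕ} (c : Chart n k) (x : Coord 𝕜 n k) :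
    Submodule.span 𝕜 (Set.range (frame c x)) = chartDelta c x := by
  cases c with
  | base =>
    have h := (Pi.basisFun 𝕜 (Fin (n + 1))).span_eq
    have e : (⇑(Pi.basisFun 𝕜 (Fin (n + 1))) : Fin (n + 1) → Fin (n + 1) → 𝕜) =
        fun j => Pi.single j 1 := by
      funext j; simp
    rw [e] at h
    exact h
  | @snoc k c i =>
    apply le_antisymm
    · rw [Submodule.span_le]
      rintro _ ⟨j, rfl⟩
      refine Fin.succAboveCases i ?_ (fun m => ?_) j
      · have h : frame (Chart.snoc c i) x i =
            Coord.mk (affineVector (frame c (Coord.proj x)) i (Coord.fib x)) 0 := by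
          simp [frame]
        rw [h]
        exact Submodule.subset_span rfl
      · have h : frame (Chart.snoc c i) x (i.succAbove m) =
            Coord.mk 0 (Pi.single m (1 : 𝕜)) := by
          simp [frame]
        rw [h]
        exact Submodule.zero_mem (chartLine c i x)
    · intro v hv
      obtain ⟨a, ha⟩ := Submodule.mem_span_singleton.1 (show Coord.proj v ∈ chartLine c i x from hv)
      have hi : frame (Chart.snoc c i) x i =
          Coord.mk (affineVector (frame c (Coord.proj x)) i (Coord.fib x)) 0 := by
        simp [frame]
      have hm : ∀ m, frame (Chart.snoc c i) x (i.succAbove m) =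
          Coord.mk 0 (Pi.single m (1 : 𝕜)) := by
        intro m; simp [frame]
      have hlin : ∀ u : Fin n → 𝕜, (Coord.mk 0 u : Coord 𝕜 n (k + 1)) =
          ∑ m, u m • frame (Chart.snoc c i) x (i.succAbove m) := by
        intro u
        have h1 : u = ∑ m, u m • (Pi.single m (1 : 𝕜) : Fin n → 𝕜) := by
          simpa using (Pi.basisFun 𝕜 (Fin n)).sum_repr u |>.symm
        have h2 := congrArg (ContinuousLinearMap.inr 𝕜 (Coord 𝕜 n k) (Fin n → 𝕜)) h1
        rw [map_sum] at h2
        simp only [hm]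
        refine Eq.trans h2 (Finset.sum_congr rfl fun m _ => ?_)
        exact map_smul (ContinuousLinearMap.inr 𝕜 (Coord 𝕜 n k) (Fin n → 𝕜)) (u m) _
      have hv' : v = a • frame (Chart.snoc c i) x i +
          ∑ m, (Coord.fib v) m • frame (Chart.snoc c i) x (i.succAbove m) := by
        rw [← hlin, hi]
        refine Prod.ext ?_ ?_
        · refine Eq.trans ha.symm ?_
          exact (add_zero (a • affineVector (frame c (Coord.proj x)) i (Coord.fib x))).symm
        · refine Eq.symm ?_
          change a • (0 : Fin n → 𝕜) + Coord.fib v = Coord.fib v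
          rw [smul_zero, zero_add]
      rw [hv']
      refine Submodule.add_mem _ (Submodule.smul_mem _ _ (Submodule.subset_span ⟨i, rfl⟩)) ?_
      exact Submodule.sum_mem _ fun m _ =>
        Submodule.smul_mem _ _ (Submodule.subset_span ⟨_, rfl⟩)

/-- The affine charts cover the projective spaces of lines in the distribution. -/
theorem exists_chartLine_eq {𝕜 : Type*} [RCLike 𝕜] {n k : ℕ} (c : Chart n k) (y : Coord 𝕜 n k)
    (l : Submodule 𝕜 (Coord 𝕜 n k)) (hl : l ≤ chartDelta c y ∧ Module.finrank 𝕜 l = 1) :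
    ∃ a : Fin (n + 1) × (Fin n → 𝕜), chartLine c a.1 (Coord.mk y a.2) = l := by
  obtain ⟨hle, h1⟩ := hl
  obtain ⟨⟨v, hvl⟩, hv0, hv⟩ := finrank_eq_one_iff'.1 h1
  have hv0' : v ≠ 0 := fun h => hv0 (Subtype.ext h)
  have hl' : l = Submodule.span 𝕜 {v} := by
    apply le_antisymm
    · intro w hw
      obtain ⟨a, ha⟩ := hv ⟨w, hw⟩
      exact Submodule.mem_span_singleton.2 ⟨a, congrArg Subtype.val ha⟩
    · rw [Submodule.span_singleton_le_iff_mem]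
      exact hvl
  have hvs : v ∈ Submodule.span 𝕜 (Set.range (frame c y)) := by
    rw [span_frame]
    exact hle hvl
  obtain ⟨b, hb⟩ := (Submodule.mem_span_range_iff_exists_fun 𝕜).1 hvs
  obtain ⟨i, hi⟩ : ∃ i, b i ≠ 0 := by
    by_contra! h
    exact hv0' (by rw [← hb]; simp [h])
  refine ⟨(i, fun m => (b i)⁻¹ * b (i.succAbove m)), ?_⟩
  have hvec : affineVector (frame c y) i (fun m => (b i)⁻¹ * b (i.succAbove m)) =
      (b i)⁻¹ • v := by
    rw [← hb, Finset.smul_sum]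
    refine Finset.sum_congr rfl fun a _ => ?_
    rw [smul_smul]
    congr 1
    refine Fin.succAboveCases i ?_ (fun m => ?_) a
    · simp [hi]
    · simp
  rw [hl']
  refine Eq.trans (congrArg (fun w => Submodule.span 𝕜 {w}) hvec) ?_
  exact Submodule.span_singleton_smul_eq (IsUnit.mk0 _ (inv_ne_zero hi)) v

/-! ### The points of the tower -/

/-- A set of points, with a chart around each of them and the coordinates of the point in it. -/
structure Level.{u} (𝕜 : Type u) (n k : ℕ) where
  Pt : Type u
  chart : Pt → Chart n k
  coord : Pt → Coord 𝕜 n k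

/-- The levels of the tower. A point of level `0` is a point of `𝕜^(n+1)`; a point of level `k + 1`
is a point `p` of level `k` with a line in `Δ_k(p)`. Around `(p, ℓ)` a chart is chosen that
extends the one around `p` by an affine chart of the fibre containing `ℓ`. -/
def level (𝕜 : Type*) [RCLike 𝕜] (n : ℕ) : (k : ℕ) → Level 𝕜 n k
  | 0 => ⟨Fin (n + 1) → 𝕜, fun _ => .base, fun p => p⟩
  | k + 1 =>
    { Pt := (p : (level 𝕜 n k).Pt) × {l : Submodule 𝕜 (Coord 𝕜 n k) //
        l ≤ chartDelta ((level 𝕜 n k).chart p) ((level 𝕜 n k).coord p) ∧ Module.finrank 𝕜 l = 1}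
      chart := fun q => ((level 𝕜 n k).chart q.1).snoc
        (Classical.choose (exists_chartLine_eq _ _ q.2.1 q.2.2)).1
      coord := fun q => Coord.mk ((level 𝕜 n k).coord q.1)
        (Classical.choose (exists_chartLine_eq _ _ q.2.1 q.2.2)).2 }

/-- The `k`-th level `P^k(n + 1)` of the Monster tower, as a set of points. -/
abbrev Point (𝕜 : Type*) [RCLike 𝕜] (n k : ℕ) := (level 𝕜 n k).Pt

/-- The chart chosen around `p`. -/
def chartAt {𝕜 : Type*} [RCLike 𝕜] {n k : ℕ} (p : Point 𝕜 n k) : Chart n k :=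
  (level 𝕜 n k).chart p

/-- The coordinates of `p` in the chart chosen around `p`. -/
def coord {𝕜 : Type*} [RCLike 𝕜] {n k : ℕ} (p : Point 𝕜 n k) : Coord 𝕜 n k :=
  (level 𝕜 n k).coord p

/-- The distribution `Δ_k(p)`, a subspace of the tangent space at `p`. -/
def Delta {𝕜 : Type*} [RCLike 𝕜] {n k : ℕ} (p : Point 𝕜 n k) : Submodule 𝕜 (Coord 𝕜 n k) :=
  chartDelta (chartAt p) (coord p)

/-- A line `ℓ ⊆ Δ_k(p)`. -/
abbrev Line {𝕜 : Type*} [RCLike 𝕜] {n k : ℕ} (p : Point 𝕜 n k) :=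
  {l : Submodule 𝕜 (Coord 𝕜 n k) // l ≤ Delta p ∧ Module.finrank 𝕜 l = 1}

/-- The point `(p, ℓ)` of the next level. -/
def Point.mk {𝕜 : Type*} [RCLike 𝕜] {n k : ℕ} (p : Point 𝕜 n k) (l : Line p) :
    Point 𝕜 n (k + 1) :=
  ⟨p, l⟩

/-- The projection of `(p, ℓ)` to `p`. -/
def Point.below {𝕜 : Type*} [RCLike 𝕜] {n k : ℕ} (q : Point 𝕜 n (k + 1)) : Point 𝕜 n k :=
  Sigma.fst q

/-- The line `ℓ` of `(p, ℓ)`. -/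
def Point.line {𝕜 : Type*} [RCLike 𝕜] {n k : ℕ} (q : Point 𝕜 n (k + 1)) : Line (Point.below q) :=
  Sigma.snd q

/-- The projection from level `k + j` to level `k`. -/
def Point.proj {𝕜 : Type*} [RCLike 𝕜] {n k : ℕ} : (j : ℕ) → Point 𝕜 n (k + j) → Point 𝕜 n k
  | 0, q => q
  | j + 1, q => Point.proj j (Point.below (k := k + j) q)

/-! ### Critical hyperplanes -/

/-- The tangent space at `x` of a submanifold `S`: it is spanned by the velocities of the analytic
curve germs in `S` through `x`. -/
def tangentTo (𝕜 : Type*) [RCLike 𝕜] {E : Type*} [NormedAddCommGroup E] [NormedSpace 𝕜 E]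
    (S : Set E) (x : E) : Submodule 𝕜 E :=
  Submodule.span 𝕜 {v | ∃ s : 𝕜 → E, AnalyticAt 𝕜 s 0 ∧ s 0 = x ∧ (∀ᶠ t in 𝓝 0, s t ∈ S) ∧
    deriv s 0 = v}

/-- The part in a chart of level `k` of the baby Monster `P^(k-i)(F_i)`, where `F_i` is the fibre
from level `i` to level `i - 1` through the projection of `x` to level `i`. It is `F_i` itself for
`k = i`; a point `(q, ℓ)` of level `k + 1 > i` belongs to it if `q` does and `ℓ` lies in the
subspace `Δ_k(q) ∩ T_q P^(k-i)(F_i)`. It is empty unless `1 ≤ i ≤ k`. -/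
def babyMonster {𝕜 : Type*} [RCLike 𝕜] {n : ℕ} (i : ℕ) :
    {k : ℕ} → Chart n k → Coord 𝕜 n k → Set (Coord 𝕜 n k)
  | _, .base, _ => ∅
  | _, .snoc (k := k) c a, x =>
    if i = k + 1 then {y | Coord.proj y = Coord.proj x}
    else {y | Coord.proj y ∈ babyMonster i c (Coord.proj x) ∧
      chartLine c a y ≤ chartDelta c (Coord.proj y) ⊓
        tangentTo 𝕜 (babyMonster i c (Coord.proj x)) (Coord.proj y)}

/-- The subspace `δ_i^(k-i)(p) = Δ_k(p) ∩ T_p P^(k-i)(F_i)`. -/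
def delta {𝕜 : Type*} [RCLike 𝕜] {n k : ℕ} (i : ℕ) (p : Point 𝕜 n k) :
    Submodule 𝕜 (Coord 𝕜 n k) :=
  Delta p ⊓ tangentTo 𝕜 (babyMonster i (chartAt p) (coord p)) (coord p)

/-- `H` is a critical hyperplane through `p`: it is `δ_i^(k-i)(p)` for some `i` such that the baby
Monster which originates from the fibre of level `i` passes through `p`. -/
def IsCritical {𝕜 : Type*} [RCLike 𝕜] {n k : ℕ} (p : Point 𝕜 n k)
    (H : Submodule 𝕜 (Coord 𝕜 n k)) : Prop :=
  ∃ i : ℕ, coord p ∈ babyMonster i (chartAt p) (coord p) ∧ H = delta i p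

/-- The vertical space `V_k(p)`. -/
def vertical {𝕜 : Type*} [RCLike 𝕜] {n k : ℕ} (_p : Point 𝕜 n k) : Submodule 𝕜 (Coord 𝕜 n k) :=
  chartVertical 𝕜 n k

/-! ### Codes -/

inductive Letter
  | R | V | T | L

open Classical in
/-- The letter of `(p, ℓ)`: `L` if `ℓ` lies in the vertical space and in another critical
hyperplane, `V` for the other vertical lines, `T` if `ℓ` is critical but not vertical, and `R` if
`ℓ` is regular. -/
def letter {𝕜 : Type*} [RCLike 𝕜] {n k : ℕ} (p : Point 𝕜 n k) (l : Line p) : Letter :=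
  if l.1 ≤ vertical p then
    if ∃ H, IsCritical p H ∧ H ≠ vertical p ∧ l.1 ≤ H then Letter.L else Letter.V
  else if ∃ H, IsCritical p H ∧ l.1 ≤ H then Letter.T else Letter.R

/-- The code of a point of level `k`, a word of length `k`. -/
def code {𝕜 : Type*} [RCLike 𝕜] {n : ℕ} : {k : ℕ} → Point 𝕜 n k → List Letter
  | 0, _ => []
  | _ + 1, q => code (Point.below q) ++ [letter (Point.below q) (Point.line q)]

/-- The class of the word `w` at level `k`. -/
def codeClass (𝕜 : Type*) [RCLike 𝕜] (n k : ℕ) (w : List Letter) : Set (Point 𝕜 n k) :=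
  {q | code q = w}

/-! ### Curves and their prolongations -/

/-- A non-constant analytic curve germ at `t = 0`. -/
def IsCurveGerm {𝕜 : Type*} [RCLike 𝕜] {n : ℕ} (γ : 𝕜 → (Fin (n + 1) → 𝕜)) : Prop :=
  AnalyticAt 𝕜 γ 0 ∧ ¬ ∀ᶠ t in 𝓝 0, γ t = γ 0

/-- The curve germ `σ` is, in the chart `c`, the `k`-th prolongation of `γ`: the prolongation `s¹`
of `s` is the analytic curve germ with `s¹(t) = (s(t), span s'(t))` for `t ≠ 0` near `0`. -/
def IsProlongation {𝕜 : Type*} [RCLike 𝕜] {n : ℕ} (γ : 𝕜 → (Fin (n + 1) → 𝕜)) :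
    {k : ℕ} → Chart n k → (𝕜 → Coord 𝕜 n k) → Prop
  | _, .base, σ => ∀ᶠ t in 𝓝 (0 : 𝕜), σ t = γ t
  | _, .snoc (k := k) c i, σ => ∃ s : 𝕜 → Coord 𝕜 n k, IsProlongation γ c s ∧
      AnalyticAt 𝕜 σ 0 ∧ (∀ᶠ t in 𝓝 (0 : 𝕜), Coord.proj (σ t) = s t) ∧
      ∀ᶠ t in 𝓝[≠] (0 : 𝕜), deriv s t ≠ 0 ∧ chartLine c i (σ t) = Submodule.span 𝕜 {deriv s t}

/-- The `k`-th prolongation of `γ` passes through `p` at `t = 0`, that is, `γ^k(0) = p`. -/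
def Touches {𝕜 : Type*} [RCLike 𝕜] {n k : ℕ} (γ : 𝕜 → (Fin (n + 1) → 𝕜)) (p : Point 𝕜 n k) :
    Prop :=
  ∃ σ : 𝕜 → Coord 𝕜 n k, IsProlongation γ (chartAt p) σ ∧ σ 0 = coord p

/-- Near `t = 0` the curve lies in a smooth submanifold of dimension at most `d`: in a suitable
analytic coordinate system around `γ 0`, all coordinates from the `d`-th on (counted from `0`)
vanish along the curve. -/
def LiesInDim {𝕜 : Type*} [RCLike 𝕜] {n : ℕ} (γ : 𝕜 → (Fin (n + 1) → 𝕜)) (d : ℕ) : Prop :=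
  ∃ φ : (Fin (n + 1) → 𝕜) → (Fin (n + 1) → 𝕜), AnalyticAt 𝕜 φ (γ 0) ∧
    Function.Bijective (fderiv 𝕜 φ (γ 0)) ∧
    ∀ᶠ t in 𝓝 (0 : 𝕜), ∀ j : Fin (n + 1), d ≤ (j : ℕ) → φ (γ t) j = 0

/-- The embedding dimension of a curve germ. -/
def embDim {𝕜 : Type*} [RCLike 𝕜] {n : ℕ} (γ : 𝕜 → (Fin (n + 1) → 𝕜)) : ℕ :=
  sInf {d | LiesInDim γ d}

/-- A planar curve germ: it lies in a smooth surface (or, in the case of an immersed curve, in a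
smooth curve). -/
def IsPlanar {𝕜 : Type*} [RCLike 𝕜] {n : ℕ} (γ : 𝕜 → (Fin (n + 1) → 𝕜)) : Prop :=
  IsCurveGerm γ ∧ embDim γ ≤ 2

/-- The set `Germ(p)` of the curve germs that realize `p`: the `k`-th prolongation passes through
`p`, is immersed there, and its tangent line is a regular direction. -/
def Germ {𝕜 : Type*} [RCLike 𝕜] {n k : ℕ} (p : Point 𝕜 n k) : Set (𝕜 → (Fin (n + 1) → 𝕜)) :=
  {γ | IsCurveGerm γ ∧ ∃ σ : 𝕜 → Coord 𝕜 n k, IsProlongation γ (chartAt p) σ ∧ σ 0 = coord p ∧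
    deriv σ 0 ≠ 0 ∧ ∀ H, IsCritical p H → deriv σ 0 ∉ H}

/-- A planar point: every curve in `Germ(p)` has embedding dimension at least `2`, and some curve in
`Germ(p)` has embedding dimension `2`. -/
def IsPlanarPoint {𝕜 : Type*} [RCLike 𝕜] {n k : ℕ} (p : Point 𝕜 n k) : Prop :=
  (∀ γ ∈ Germ p, 2 ≤ embDim γ) ∧ ∃ γ ∈ Germ p, embDim γ = 2

end

end Monster

/-! In the frame of a chart, a line has homogeneous coordinates, one of them normalised to 1. A
critical hyperplane that originates from level `i` lies in the coordinate hyperplane on which the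
coefficient at one place `b` vanishes, where `b` is the place of the affine chart used at level `i`
(`babyMonster_bound`); only this inclusion is needed. Hence a line in that hyperplane makes the new
point satisfy `Avoids i b`.

A planar curve lies in a smooth surface `S`, and its prolongations lie in the prolongations of `S`,
which carry a plane field inside the distribution. This plane contains the velocity, so by
continuity the line at `t = 0` also lies in it. The plane at `0` is spanned by `X` and `w`. Here `w`
is vertical and `X` is not, while `w` lies in no critical hyperplane from a lower level. So the
plane meets each critical hyperplane in a line: the vertical one along `w`, every other one along
another line. No line of the plane lies in two of them, one of which is vertical. Two non-vertical
ones reduce to a lower level, because both conditions already hold there. This is the induction of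
`exists_planeField_prolongation`.

The inductive step is `IsPlaneField.exists_prolonged`. The new vertical direction turns the line
inside the old plane. Since the old plane is not contained in the hyperplane, this moves the line
out of it to first order. Everything is carried out along the curve only: a differential ring of
germs in `t` replaces the functions on the prolonged surface. -/

namespace Monster

noncomputable section

variable {𝕜 : Type*} [RCLike 𝕜] {n k : ℕ}

/-! ### The frame of the distribution -/

/-- The vector of the distribution with given coefficients with respect to the frame. -/
def frameVector (c : Chart n k) (x : Coord 𝕜 n k) (v : Fin (n + 1) → 𝕜) : Coord 𝕜 n k :=
  ∑ b, v b • frame c x b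

theorem frame_snoc_self (c : Chart n k) (a : Fin (n + 1)) (x : Coord 𝕜 n (k + 1)) :
    frame (c.snoc a) x a = Coord.mk (affineVector (frame c (Coord.proj x)) a (Coord.fib x)) 0 := by
  simp [frame]

theorem frame_snoc_succAbove (c : Chart n k) (a : Fin (n + 1)) (x : Coord 𝕜 n (k + 1))
    (m : Fin n) : frame (c.snoc a) x (a.succAbove m) = Coord.mk 0 (Pi.single m (1 : 𝕜)) := by
  simp [frame]

theorem proj_frameVector (c : Chart n k) (a : Fin (n + 1)) (x : Coord 𝕜 n (k + 1))
    (v : Fin (n + 1) → 𝕜) : Coord.proj (frameVector (c.snoc a) x v) =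
      v a • affineVector (frame c (Coord.proj x)) a (Coord.fib x) := by
  rw [frameVector, map_sum, Fin.sum_univ_succAbove _ a]
  simp only [map_smul, frame_snoc_self, frame_snoc_succAbove]
  have h : ∀ m : Fin n, Coord.proj (Coord.mk 0 (Pi.single m (1 : 𝕜)) : Coord 𝕜 n (k + 1)) = 0 :=
    fun m => rfl
  simp only [h, smul_zero, Finset.sum_const_zero, add_zero]
  rfl

theorem fib_frameVector (c : Chart n k) (a : Fin (n + 1)) (x : Coord 𝕜 n (k + 1))
    (v : Fin (n + 1) → 𝕜) (m : Fin n) :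
    Coord.fib (frameVector (c.snoc a) x v) m = v (a.succAbove m) := by
  rw [frameVector, map_sum, Fin.sum_univ_succAbove _ a]
  simp only [map_smul, frame_snoc_self, frame_snoc_succAbove]
  have h : ∀ m : Fin n, Coord.fib (Coord.mk 0 (Pi.single m (1 : 𝕜)) : Coord 𝕜 n (k + 1)) =
      Pi.single m 1 := fun m => rfl
  have h' : Coord.fib (Coord.mk (affineVector (frame c (Coord.proj x)) a (Coord.fib x)) 0 :
      Coord 𝕜 n (k + 1)) = (0 : Fin n → 𝕜) := rfl
  simp [h, h', Pi.single_apply]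

theorem affineVector_frame (c : Chart n k) (y : Coord 𝕜 n k) (a : Fin (n + 1)) (u : Fin n → 𝕜) :
    affineVector (frame c y) a u =
      frameVector c y (a.insertNth (α := fun _ => 𝕜) 1 u) := rfl

theorem frameVector_base (x : Coord 𝕜 n 0) (v : Fin (n + 1) → 𝕜) :
    frameVector (Chart.base) x v = v := by
  have h := (Pi.basisFun 𝕜 (Fin (n + 1))).sum_repr v
  simp only [Pi.basisFun_repr, Pi.basisFun_apply] at h
  exact h

theorem smul_frameVector (c : Chart n k) (x : Coord 𝕜 n k) (z : 𝕜) (v : Fin (n + 1) → 𝕜) :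
    z • frameVector c x v = frameVector c x (z • v) := by
  simp [frameVector, Finset.smul_sum, smul_smul]

theorem frameVector_zero (c : Chart n k) (x : Coord 𝕜 n k) : frameVector c x 0 = 0 := by
  simp [frameVector]

theorem frameVector_sub (c : Chart n k) (x : Coord 𝕜 n k) (v w : Fin (n + 1) → 𝕜) :
    frameVector c x (v - w) = frameVector c x v - frameVector c x w := by
  simp [frameVector, sub_smul]

/-- The fibre coordinates of the vector are its coefficients away from place `a`. Its projection is
the coefficient at `a` times a vector that is nonzero by induction, having coefficient 1 at `a`. -/
theorem eq_zero_of_frameVector_eq_zero (c : Chart n k) (x : Coord 𝕜 n k) (v : Fin (n + 1) → 𝕜)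
    (h : frameVector c x v = 0) : v = 0 := by
  induction c generalizing v with
  | base => rwa [frameVector_base] at h
  | snoc c a ih =>
    have hm : ∀ m, v (a.succAbove m) = 0 := fun m => by
      rw [← fib_frameVector c a x v m, h, map_zero, Pi.zero_apply]
    have ha : v a = 0 := by
      have h1 := proj_frameVector c a x v
      rw [h, map_zero, affineVector_frame, smul_frameVector] at h1
      simpa using congrFun (ih _ _ h1.symm) a
    funext j
    exact Fin.succAboveCases a ha hm j

theorem frameVector_injective (c : Chart n k) (x : Coord 𝕜 n k) :
    Function.Injective (frameVector c x) := fun v w h =>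
  sub_eq_zero.1 (eq_zero_of_frameVector_eq_zero c x _ (by rw [frameVector_sub, h, sub_self]))

/-! ### Critical hyperplanes as coordinate hyperplanes -/

/-- The homogeneous coordinates, with respect to the frame, of the line represented by `x`. -/
def homCoord (a : Fin (n + 1)) (x : Coord 𝕜 n (k + 1)) : Fin (n + 1) → 𝕜 :=
  a.insertNth (α := fun _ => 𝕜) 1 (Coord.fib x)

theorem homCoord_self (a : Fin (n + 1)) (x : Coord 𝕜 n (k + 1)) : homCoord a x a = 1 := by
  simp [homCoord]

theorem homCoord_succAbove (a : Fin (n + 1)) (x : Coord 𝕜 n (k + 1)) (m : Fin n) :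
    homCoord a x (a.succAbove m) = Coord.fib x m := by
  simp [homCoord]

/-- The level `i` of the chart uses the `b`-th affine chart, and the lines of the levels above `i`
lie in the hyperplane on which the `b`-th coefficient vanishes. -/
def Avoids (i : ℕ) (b : Fin (n + 1)) : {k : ℕ} → Chart n k → Coord 𝕜 n k → Prop
  | _, .base, _ => False
  | _, .snoc (k := k) c a, x =>
    if i = k + 1 then b = a else Avoids i b c (Coord.proj x) ∧ homCoord a x b = 0

theorem avoids_top {i : ℕ} {b : Fin (n + 1)} {c : Chart n k} {a : Fin (n + 1)}
    {x : Coord 𝕜 n (k + 1)} (hi : i = k + 1) : Avoids i b (c.snoc a) x ↔ b = a := by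
  simp [Avoids, hi]

theorem avoids_snoc {i : ℕ} {b : Fin (n + 1)} {c : Chart n k} {a : Fin (n + 1)}
    {x : Coord 𝕜 n (k + 1)} (hi : i ≠ k + 1) :
    Avoids i b (c.snoc a) x ↔ Avoids i b c (Coord.proj x) ∧ homCoord a x b = 0 := by
  simp [Avoids, hi]

theorem Avoids.le {i : ℕ} {b : Fin (n + 1)} {c : Chart n k} {x : Coord 𝕜 n k}
    (h : Avoids i b c x) : i ≤ k := by
  induction c with
  | base => exact h.elim
  | @snoc k c a ih =>
    by_cases hi : i = k + 1
    · exact hi.le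
    · exact (ih ((avoids_snoc hi).1 h).1).trans k.le_succ

/-- Velocities of curves in a level set of `L` are killed by `L`. Upper bounds of this kind make it
unnecessary to know that a baby Monster is a submanifold. -/
theorem tangentTo_le_ker {E G : Type*} [NormedAddCommGroup E] [NormedSpace 𝕜 E]
    [NormedAddCommGroup G] [NormedSpace 𝕜 G] (S : Set E) (x : E) (L : E →L[𝕜] G) (z : G)
    (hS : ∀ y ∈ S, L y = z) : tangentTo 𝕜 S x ≤ LinearMap.ker L.toLinearMap := by
  rw [tangentTo, Submodule.span_le]
  rintro v ⟨s, hs, -, hmem, rfl⟩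
  have h1 : HasDerivAt (fun t => L (s t)) (L (deriv s 0)) 0 :=
    L.hasFDerivAt.comp_hasDerivAt 0 hs.differentiableAt.hasDerivAt
  have h2 : (fun t => L (s t)) =ᶠ[𝓝 0] fun _ => z := hmem.mono fun t ht => hS _ ht
  exact h1.unique ((hasDerivAt_const (0 : 𝕜) z).congr_of_eventuallyEq h2)

/-- On the fibre itself, tangent vectors project to 0, which kills the coefficient at the chart
place `a`. Above it, the lines of the baby Monster have coordinate 0 at the same `b`. That
coordinate is an affine fibre coordinate, and its differential is the coefficient at `b` one level
up, so the condition propagates. -/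
theorem babyMonster_bound (i : ℕ) (c : Chart n k) (x : Coord 𝕜 n k) :
    ∃ b, ∀ y ∈ babyMonster i c x, Avoids i b c y ∧
      ∀ v, frameVector c y v ∈ tangentTo 𝕜 (babyMonster i c x) y → v b = 0 := by
  induction c with
  | base => exact ⟨0, fun y hy => hy.elim⟩
  | @snoc k c a ih =>
    by_cases hi : i = k + 1
    · have hS : babyMonster i (c.snoc a) x = {y | Coord.proj y = Coord.proj x} := by
        simp [babyMonster, hi]
      refine ⟨a, fun y _ => ⟨(avoids_top hi).2 rfl, fun v hv => ?_⟩⟩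
      rw [hS] at hv
      have h0 : Coord.proj (frameVector (c.snoc a) y v) = 0 :=
        tangentTo_le_ker _ y Coord.proj _ (fun y hy => hy) hv
      rw [proj_frameVector, affineVector_frame, smul_frameVector] at h0
      simpa using congrFun (eq_zero_of_frameVector_eq_zero _ _ _ h0) a
    · obtain ⟨b, hb⟩ := ih (Coord.proj x)
      have hS : babyMonster i (c.snoc a) x = {y | Coord.proj y ∈ babyMonster i c (Coord.proj x) ∧
          chartLine c a y ≤ chartDelta c (Coord.proj y) ⊓
            tangentTo 𝕜 (babyMonster i c (Coord.proj x)) (Coord.proj y)} := by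
        rw [babyMonster, if_neg hi]
      have hav : ∀ y ∈ babyMonster i (c.snoc a) x, Avoids i b (c.snoc a) y := by
        intro y hy
        rw [hS] at hy
        refine (avoids_snoc hi).2 ⟨(hb _ hy.1).1, (hb _ hy.1).2 _ ?_⟩
        exact (hy.2 (Submodule.mem_span_singleton_self _)).2
      refine ⟨b, fun y hy => ⟨hav y hy, fun v hv => ?_⟩⟩
      -- The coordinate at `a` is normalised to 1, so the vanishing one is a genuine fibre
      -- coordinate.
      have hba : b ≠ a := by
        rintro rfl
        have := ((avoids_snoc hi).1 (hav y hy)).2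
        rw [homCoord_self] at this
        exact one_ne_zero this
      obtain ⟨m, rfl⟩ := Fin.exists_succAbove_eq hba
      rw [← fib_frameVector c a y v m]
      refine tangentTo_le_ker _ y
        ((ContinuousLinearMap.proj (R := 𝕜) (φ := fun _ : Fin n => 𝕜) m).comp Coord.fib) 0 ?_ hv
      intro y' hy'
      rw [← ((avoids_snoc hi).1 (hav y' hy')).2, homCoord_succAbove]
      rfl

/-- The line of a point lies in the critical hyperplane originating from level `i` only if the point
avoids the direction of level `i`. -/
theorem exists_avoids (i : ℕ) (p : Point 𝕜 n k) (l : Line p)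
    (hp : coord p ∈ babyMonster i (chartAt p) (coord p)) (hl : l.1 ≤ delta i p) :
    i < k + 1 ∧
      ∃ b, Avoids i b (chartAt (Point.mk p l)) (coord (Point.mk p l)) := by
  obtain ⟨b, hb⟩ := babyMonster_bound i (chartAt p) (coord p)
  obtain ⟨h1, h2⟩ := hb _ hp
  have hspec := Classical.choose_spec (exists_chartLine_eq (chartAt p) (coord p) l.1 l.2)
  refine ⟨Nat.lt_succ_of_le h1.le, b, (avoids_snoc (Nat.lt_succ_of_le h1.le).ne).2 ⟨h1, h2 _ ?_⟩⟩
  refine (hl ?_).2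
  rw [← hspec]
  exact Submodule.mem_span_singleton_self _

/-- The vertical space is the critical hyperplane originating from the last level. -/
theorem delta_self (p : Point 𝕜 n (k + 1)) : delta (k + 1) p = vertical p := by
  have key : ∀ (c : Chart n (k + 1)) (x : Coord 𝕜 n (k + 1)),
      chartDelta c x ⊓ tangentTo 𝕜 (babyMonster (k + 1) c x) x = chartVertical 𝕜 n (k + 1) := by
    intro c x
    cases c with
    | snoc c a =>
      have hS : babyMonster (k + 1) (c.snoc a) x = {y | Coord.proj y = Coord.proj x} := by
        simp [babyMonster]
      rw [hS]
      refine le_antisymm (fun v hv => tangentTo_le_ker _ x Coord.proj _ (fun y hy => hy) hv.2) ?_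
      intro v hv
      have hv0 : Coord.proj v = 0 := hv
      refine ⟨?_, Submodule.subset_span ⟨fun t => x + t • v, ?_, by simp, ?_, ?_⟩⟩
      · change Coord.proj v ∈ chartLine c a x
        rw [hv0]
        exact Submodule.zero_mem _
      · fun_prop
      · refine Eventually.of_forall fun t => ?_
        change Coord.proj (x + t • v) = Coord.proj x
        rw [map_add, map_smul, hv0, smul_zero, add_zero]
      · have : HasDerivAt (fun t : 𝕜 => x + t • v) ((1 : 𝕜) • v) 0 :=
          ((hasDerivAt_id (0 : 𝕜)).smul_const v).const_add x
        rw [this.deriv, one_smul]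
  exact key _ _

theorem isCritical_vertical (p : Point 𝕜 n (k + 1)) : IsCritical p (vertical p) := by
  refine ⟨k + 1, ?_, (delta_self p).symm⟩
  have key : ∀ (c : Chart n (k + 1)) (x : Coord 𝕜 n (k + 1)), x ∈ babyMonster (k + 1) c x := by
    intro c x
    cases c with
    | snoc c a => simp [babyMonster]
  exact key _ _

/-! ### Differential rings of analytic germs -/

/-- A ring of analytic germs at `0`, closed under inverses of units, such that the derivatives of its
elements are combinations of `f` and `g` with coefficients in the ring. -/
structure IsDifferentialRing (R : Set (𝕜 → 𝕜)) (f g : 𝕜 → 𝕜) : Prop where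
  analyticAt : ∀ h ∈ R, AnalyticAt 𝕜 h 0
  const_mem : ∀ z : 𝕜, (fun _ => z) ∈ R
  add_mem : ∀ h ∈ R, ∀ h' ∈ R, h + h' ∈ R
  mul_mem : ∀ h ∈ R, ∀ h' ∈ R, h * h' ∈ R
  inv_mem : ∀ h ∈ R, h 0 ≠ 0 → h⁻¹ ∈ R
  deriv_eq : ∀ h ∈ R, ∃ p ∈ R, ∃ q ∈ R, ∀ᶠ t in 𝓝[≠] (0 : 𝕜), deriv h t = p t * f t + q t * g t

theorem IsDifferentialRing.swap {R : Set (𝕜 → 𝕜)} {f g : 𝕜 → 𝕜} (hR : IsDifferentialRing R f g) :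
    IsDifferentialRing R g f where
  analyticAt := hR.analyticAt
  const_mem := hR.const_mem
  add_mem := hR.add_mem
  mul_mem := hR.mul_mem
  inv_mem := hR.inv_mem
  deriv_eq h hh := by
    obtain ⟨p, hp, q, hq, he⟩ := hR.deriv_eq h hh
    exact ⟨q, hq, p, hp, he.mono fun t ht => ht.trans (add_comm _ _)⟩

/-- The functions obtained from `R` and `v` by the ring operations and inverses of units. -/
inductive Adjoin (R : Set (𝕜 → 𝕜)) (v : 𝕜 → 𝕜) : (𝕜 → 𝕜) → Prop
  | of (h : 𝕜 → 𝕜) (hh : h ∈ R) : Adjoin R v h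
  | gen : Adjoin R v v
  | add (h h' : 𝕜 → 𝕜) : Adjoin R v h → Adjoin R v h' → Adjoin R v (h + h')
  | mul (h h' : 𝕜 → 𝕜) : Adjoin R v h → Adjoin R v h' → Adjoin R v (h * h')
  | inv (h : 𝕜 → 𝕜) : Adjoin R v h → h 0 ≠ 0 → Adjoin R v h⁻¹

theorem eventually_differentiableAt {h : 𝕜 → 𝕜} (hh : AnalyticAt 𝕜 h 0) :
    ∀ᶠ t in 𝓝[≠] (0 : 𝕜), DifferentiableAt 𝕜 h t :=
  (hh.eventually_analyticAt.mono fun _ ht => ht.differentiableAt).filter_mono nhdsWithin_le_nhds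

/-- The slope `v = g / f` is the new fibre coordinate of the prolonged surface. Since `f` and `g = v
* f` are both multiples of `F` over the new ring, old derivatives become multiples of `F`; the only
new derivative is that of `v`. -/
theorem isDifferentialRing_adjoin {R : Set (𝕜 → 𝕜)} {f g v r F : 𝕜 → 𝕜}
    (hR : IsDifferentialRing R f g) (hv : AnalyticAt 𝕜 v 0) (hr : Adjoin R v r)
    (hg : ∀ᶠ t in 𝓝[≠] (0 : 𝕜), g t = v t * f t) (hf : ∀ᶠ t in 𝓝[≠] (0 : 𝕜), f t = r t * F t) :
    IsDifferentialRing {h | Adjoin R v h} F (deriv v) := by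
  have hc : ∀ z : 𝕜, Adjoin R v fun _ => z := fun z => .of _ (hR.const_mem z)
  have key : ∀ h, Adjoin R v h → AnalyticAt 𝕜 h 0 ∧ ∃ p, Adjoin R v p ∧ ∃ q, Adjoin R v q ∧
      ∀ᶠ t in 𝓝[≠] (0 : 𝕜), deriv h t = p t * F t + q t * deriv v t := by
    intro h hh
    induction hh with
    | of h hh =>
      obtain ⟨p, hp, q, hq, he⟩ := hR.deriv_eq h hh
      refine ⟨hR.analyticAt h hh, (p + q * v) * r,
        .mul _ _ (.add _ _ (.of _ hp) (.mul _ _ (.of _ hq) .gen)) hr, _, hc 0, ?_⟩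
      filter_upwards [he, hg, hf] with t h1 h2 h3
      simp only [Pi.mul_apply, Pi.add_apply]
      rw [h1, h2, h3]
      ring
    | gen => exact ⟨hv, _, hc 0, _, hc 1, by simp⟩
    | add h h' _ _ ih ih' =>
      obtain ⟨ha, p, hp, q, hq, he⟩ := ih
      obtain ⟨ha', p', hp', q', hq', he'⟩ := ih'
      refine ⟨ha.add ha', _, .add _ _ hp hp', _, .add _ _ hq hq', ?_⟩
      filter_upwards [he, he', eventually_differentiableAt ha, eventually_differentiableAt ha']
        with t h1 h2 h3 h4
      rw [deriv_add h3 h4, h1, h2]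
      simp only [Pi.add_apply]
      ring
    | mul h h' hm hm' ih ih' =>
      obtain ⟨ha, p, hp, q, hq, he⟩ := ih
      obtain ⟨ha', p', hp', q', hq', he'⟩ := ih'
      refine ⟨ha.mul ha', p * h' + h * p', .add _ _ (.mul _ _ hp hm') (.mul _ _ hm hp'),
        q * h' + h * q', .add _ _ (.mul _ _ hq hm') (.mul _ _ hm hq'), ?_⟩
      filter_upwards [he, he', eventually_differentiableAt ha, eventually_differentiableAt ha']
        with t h1 h2 h3 h4
      rw [deriv_mul h3 h4, h1, h2]
      simp only [Pi.add_apply, Pi.mul_apply]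
      ring
    | inv h hm h0 ih =>
      obtain ⟨ha, p, hp, q, hq, he⟩ := ih
      have hi : Adjoin R v ((fun _ => -1) * (h⁻¹ * h⁻¹)) :=
        .mul _ _ (hc _) (.mul _ _ (.inv _ hm h0) (.inv _ hm h0))
      refine ⟨ha.inv h0, _, .mul _ _ hi hp, _, .mul _ _ hi hq, ?_⟩
      filter_upwards [he, eventually_differentiableAt ha,
        (ha.continuousAt.eventually_ne h0).filter_mono nhdsWithin_le_nhds] with t h1 h2 h3
      rw [(h2.hasDerivAt.inv h3).deriv, h1]
      simp only [Pi.mul_apply, Pi.inv_apply]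
      field_simp
      ring
  exact ⟨fun h hh => (key h hh).1, hc, fun h hh h' hh' => .add _ _ hh hh',
    fun h hh h' hh' => .mul _ _ hh hh', fun h hh h0 => .inv _ hh h0, fun h hh => (key h hh).2⟩

/-! ### Prolongation of a plane field along a curve -/

/-- The functions `f * X + g * w` are the coefficients of the velocity of a curve; the plane spanned
by `X` and `w` has entries in a differential ring. -/
structure IsPlaneField (R : Set (𝕜 → 𝕜)) (f g : 𝕜 → 𝕜) (X w : Fin (n + 1) → 𝕜 → 𝕜) : Prop where
  ring : IsDifferentialRing R f g
  mem_left : ∀ b, X b ∈ R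
  mem_right : ∀ b, w b ∈ R
  indep : ∃ b b', X b 0 * w b' 0 - X b' 0 * w b 0 ≠ 0

theorem IsPlaneField.swap {R : Set (𝕜 → 𝕜)} {f g : 𝕜 → 𝕜} {X w : Fin (n + 1) → 𝕜 → 𝕜}
    (h : IsPlaneField R f g X w) : IsPlaneField R g f w X := by
  obtain ⟨b, b', hb⟩ := h.indep
  exact ⟨h.ring.swap, h.mem_right, h.mem_left, b', b, fun h0 => hb (by linear_combination h0)⟩

/-- The relation between a plane field and its prolongation along the curve of lines `U`. -/
structure IsProlongedField (f g : 𝕜 → 𝕜) (X w : Fin (n + 1) → 𝕜 → 𝕜) (a : Fin (n + 1))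
    (U : Fin (n + 1) → 𝕜 → 𝕜) (f' g' : 𝕜 → 𝕜) (X' w' : Fin (n + 1) → 𝕜 → 𝕜) : Prop where
  left_self : X' a 0 = 1
  right_self : w' a 0 = 0
  right_ne : ∀ b, U b 0 = 0 → X b 0 ≠ 0 ∨ w b 0 ≠ 0 → w' b 0 ≠ 0
  coeff_self : ∀ᶠ t in 𝓝[≠] (0 : 𝕜),
    X' a t * f' t + w' a t * g' t = X a t * f t + w a t * g t
  coeff_ne : ∀ᶠ t in 𝓝[≠] (0 : 𝕜), ∀ b, b ≠ a → X' b t * f' t + w' b t * g' t = deriv (U b) t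

/-- The case in which the line at `0` is not spanned by `w`, so that its slope `v = q / p` is finite
and the line is that of `X + v * w`. -/
theorem IsPlaneField.exists_prolonged_of_ne {R : Set (𝕜 → 𝕜)} {f g p q : 𝕜 → 𝕜}
    {X w U : Fin (n + 1) → 𝕜 → 𝕜} {a : Fin (n + 1)} (h : IsPlaneField R f g X w)
    (hp : AnalyticAt 𝕜 p 0) (hq : AnalyticAt 𝕜 q 0) (hp0 : p 0 ≠ 0)
    (hf : ∀ᶠ t in 𝓝[≠] (0 : 𝕜), f t = p t * (X a t * f t + w a t * g t))
    (hg : ∀ᶠ t in 𝓝[≠] (0 : 𝕜), g t = q t * (X a t * f t + w a t * g t))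
    (hU : ∀ᶠ t in 𝓝 (0 : 𝕜), ∀ b, U b t = p t * X b t + q t * w b t)
    (hUa : ∀ᶠ t in 𝓝 (0 : 𝕜), U a t = 1) :
    ∃ R' f' g' X' w', IsPlaneField R' f' g' X' w' ∧
      IsProlongedField f g X w a U f' g' X' w' := by
  obtain ⟨hR, hX, hw, b₁, b₂, hmin⟩ := h
  set v : 𝕜 → 𝕜 := q / p with hvdef
  have hv : AnalyticAt 𝕜 v 0 := hq.div hp hp0
  have hpne : ∀ᶠ t in 𝓝 (0 : 𝕜), p t ≠ 0 := hp.continuousAt.eventually_ne hp0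
  -- This is the inverse of `p`, because `U a = 1`. Unlike `p`, it is visibly an element of the
  -- extended ring.
  set d : 𝕜 → 𝕜 := X a + v * w a with hd
  have hpd : ∀ᶠ t in 𝓝 (0 : 𝕜), p t * d t = 1 := by
    filter_upwards [hU, hUa, hpne] with t h1 h2 h3
    rw [← h2, h1 a]
    simp only [hd, hvdef, Pi.add_apply, Pi.mul_apply, Pi.div_apply]
    field_simp
  have hd0 : d 0 ≠ 0 := fun h0 => by simpa [h0] using hpd.self_of_nhds
  have hdA : Adjoin R v d := .add _ _ (.of _ (hX a)) (.mul _ _ .gen (.of _ (hw a)))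
  have hrA : Adjoin R v d⁻¹ := .inv _ hdA hd0
  set F : 𝕜 → 𝕜 := fun t => X a t * f t + w a t * g t with hF
  have hgv : ∀ᶠ t in 𝓝[≠] (0 : 𝕜), g t = v t * f t := by
    filter_upwards [hf, hg, hpne.filter_mono nhdsWithin_le_nhds] with t h1 h2 h3
    have h4 : v t * p t = q t := div_mul_cancel₀ _ h3
    linear_combination h2 - v t * h1 - (X a t * f t + w a t * g t) * h4
  have hfr : ∀ᶠ t in 𝓝[≠] (0 : 𝕜), f t = d⁻¹ t * F t := by
    filter_upwards [hf, hpd.filter_mono nhdsWithin_le_nhds] with t h1 h2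
    rw [Pi.inv_apply, ← eq_inv_of_mul_eq_one_left h2]
    exact h1
  have hR' := isDifferentialRing_adjoin hR hv hrA hgv hfr
  have hder : ∀ h ∈ R, ∃ h', Adjoin R v h' ∧
      ∀ᶠ t in 𝓝[≠] (0 : 𝕜), HasDerivAt h (h' t * F t) t := by
    intro h hh
    obtain ⟨α, hα, β, hβ, he⟩ := hR.deriv_eq h hh
    refine ⟨(α + β * v) * d⁻¹,
      .mul _ _ (.add _ _ (.of _ hα) (.mul _ _ (.of _ hβ) .gen)) hrA, ?_⟩
    filter_upwards [he, hgv, hfr, eventually_differentiableAt (hR.analyticAt h hh)]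
      with t h1 h2 h3 h4
    have h5 : ((α + β * v) * d⁻¹) t * F t = deriv h t := by
      rw [h1, h2, h3]
      simp only [Pi.mul_apply, Pi.add_apply]
      ring
    rw [h5]
    exact h4.hasDerivAt
  choose X₁ hX₁ hX₁d using fun b => hder (X b) (hX b)
  choose w₁ hw₁ hw₁d using fun b => hder (w b) (hw b)
  have hneg : Adjoin R v fun _ => (-1 : 𝕜) := .of _ (hR.const_mem _)
  -- Quotient rule for `U b = (X b + v * w b) / d`: `w'` is the derivative in `v` with `X` and `w`
  -- fixed, and `X' * F` is the derivative with `v` fixed.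
  set w' : Fin (n + 1) → 𝕜 → 𝕜 := fun b =>
    d⁻¹ * w b + (fun _ => (-1 : 𝕜)) * (d⁻¹ * d⁻¹ * w a * (X b + v * w b)) with hw'
  set X' : Fin (n + 1) → 𝕜 → 𝕜 := fun b => d⁻¹ * (X₁ b + v * w₁ b) +
    (fun _ => (-1 : 𝕜)) * (d⁻¹ * d⁻¹ * (X₁ a + v * w₁ a) * (X b + v * w b)) with hX'
  have hw'A : ∀ b, Adjoin R v (w' b) := fun b =>
    .add _ _ (.mul _ _ hrA (.of _ (hw b))) (.mul _ _ hneg (.mul _ _ (.mul _ _ (.mul _ _ hrA hrA)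
      (.of _ (hw a))) (.add _ _ (.of _ (hX b)) (.mul _ _ .gen (.of _ (hw b))))))
  have hX'A : ∀ b, Adjoin R v (X' b) := fun b =>
    .add _ _ (.mul _ _ hrA (.add _ _ (hX₁ b) (.mul _ _ .gen (hw₁ b)))) (.mul _ _ hneg (.mul _ _
      (.mul _ _ (.mul _ _ hrA hrA) (.add _ _ (hX₁ a) (.mul _ _ .gen (hw₁ a))))
      (.add _ _ (.of _ (hX b)) (.mul _ _ .gen (.of _ (hw b))))))
  have hUd : ∀ b, ∀ᶠ t in 𝓝 (0 : 𝕜), U b t = (d⁻¹ * (X b + v * w b)) t := by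
    intro b
    filter_upwards [hU, hpd, hpne] with t h1 h2 h3
    rw [h1 b, Pi.mul_apply, Pi.inv_apply, ← eq_inv_of_mul_eq_one_left h2]
    simp only [hvdef, Pi.add_apply, Pi.mul_apply, Pi.div_apply]
    field_simp
  have hderU : ∀ b, ∀ᶠ t in 𝓝[≠] (0 : 𝕜),
      X' b t * F t + w' b t * deriv v t = deriv (U b) t := by
    intro b
    filter_upwards [hX₁d b, hw₁d b, hX₁d a, hw₁d a, eventually_differentiableAt hv,
      (hUd b).eventually_nhds.filter_mono nhdsWithin_le_nhds,
      hpd.filter_mono nhdsWithin_le_nhds] with t h1 h2 h3 h4 h5 h6 h7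
    have hdt : d t ≠ 0 := fun h0 => by simp [h0] at h7
    have hdd : HasDerivAt d _ t := h3.add (h5.hasDerivAt.mul h4)
    have h8 := (hdd.inv hdt).mul (h1.add (h5.hasDerivAt.mul h2))
    have h9 : deriv (U b) t = deriv (d⁻¹ * (X b + v * w b)) t := EventuallyEq.deriv_eq h6
    rw [h9, h8.deriv]
    simp only [hX', hw', Pi.add_apply, Pi.mul_apply, Pi.inv_apply]
    field_simp
    ring
  have hw'0 : ∀ b, w' b 0 = (d 0)⁻¹ * w b 0 -
      (d 0)⁻¹ * (d 0)⁻¹ * w a 0 * (X b 0 + v 0 * w b 0) := by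
    intro b
    simp only [hw', Pi.add_apply, Pi.mul_apply, Pi.inv_apply]
    ring
  have hw'a : w' a 0 = 0 := by
    have : X a 0 + v 0 * w a 0 = d 0 := rfl
    rw [hw'0, this]
    field_simp
    ring
  -- Otherwise `w` would be a multiple of `X + v * w` at `0`, against the independence of `X` and
  -- `w`.
  obtain ⟨b₃, hb₃⟩ : ∃ b, w' b 0 ≠ 0 := by
    by_contra! hall
    have h1 : ∀ b, w b 0 = (d 0)⁻¹ * w a 0 * (X b 0 + v 0 * w b 0) := by
      intro b
      have := hall b
      rw [hw'0] at this
      field_simp at this ⊢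
      linear_combination this
    apply hmin
    linear_combination (X b₁ 0 + v 0 * w b₁ 0) * h1 b₂ - (X b₂ 0 + v 0 * w b₂ 0) * h1 b₁
  -- Place `a` of the new frame is the lift of the line, and the velocity has coefficient `F` there;
  -- hence the entries 1 and 0. The minor at `a`, `b₃` then equals `w' b₃ 0`.
  refine ⟨_, F, deriv v, Function.update X' a fun _ => 1, Function.update w' a fun _ => 0,
    ⟨hR', ?_, ?_, a, b₃, ?_⟩, ⟨by simp, by simp, ?_, ?_, ?_⟩⟩
  · intro b
    by_cases hb : b = a
    · subst hb; simpa using hR'.const_mem 1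
    · simpa [hb] using hX'A b
  · intro b
    by_cases hb : b = a
    · subst hb; simpa using hR'.const_mem 0
    · simpa [hb] using hw'A b
  · have : b₃ ≠ a := by rintro rfl; exact hb₃ hw'a
    simpa [this] using hb₃
  · intro b hb0 hb
    have h1 := (hUd b).self_of_nhds
    rw [hb0] at h1
    simp only [Pi.mul_apply, Pi.inv_apply, Pi.add_apply] at h1
    have h2 : X b 0 + v 0 * w b 0 = 0 := by
      rcases mul_eq_zero.1 h1.symm with h3 | h3
      · exact absurd h3 (inv_ne_zero hd0)
      · exact h3
    have hba : b ≠ a := by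
      rintro rfl
      rw [hUa.self_of_nhds] at hb0
      exact one_ne_zero hb0
    rw [Function.update_of_ne hba, hw'0, h2, mul_zero, sub_zero]
    -- Since `X b + v * w b` vanishes at `0`, `w b 0 = 0` would force `X b 0 = 0` too.
    refine mul_ne_zero (inv_ne_zero hd0) fun h3 => ?_
    rw [h3, mul_zero, add_zero] at h2
    exact hb.elim (fun h => h h2) fun h => h h3
  · exact Eventually.of_forall fun t => by simp [hF]
  · filter_upwards [eventually_all.2 hderU] with t ht b hb
    simpa [hb] using ht b

/-- A plane field along a curve, which contains the velocities, can be prolonged along the curve of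
the tangent lines; at `0` the line lies in the plane. -/
theorem IsPlaneField.exists_prolonged {R : Set (𝕜 → 𝕜)} {f g : 𝕜 → 𝕜}
    {X w U : Fin (n + 1) → 𝕜 → 𝕜} {a : Fin (n + 1)} (h : IsPlaneField R f g X w)
    (hU : ∀ b, AnalyticAt 𝕜 (U b) 0) (hUa : ∀ t, U a t = 1)
    (hF : ∀ᶠ t in 𝓝[≠] (0 : 𝕜), X a t * f t + w a t * g t ≠ 0 ∧
      ∀ b, X b t * f t + w b t * g t = (X a t * f t + w a t * g t) * U b t) :
    (∃ α β : 𝕜, ∀ b, U b 0 = α * X b 0 + β * w b 0) ∧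
    ∃ R' f' g' X' w', IsPlaneField R' f' g' X' w' ∧
      IsProlongedField f g X w a U f' g' X' w' := by
  obtain ⟨b, b', hm⟩ := h.indep
  have hXa := fun b => h.ring.analyticAt _ (h.mem_left b)
  have hwa := fun b => h.ring.analyticAt _ (h.mem_right b)
  set m : 𝕜 → 𝕜 := X b * w b' - X b' * w b with hmdef
  have hma : AnalyticAt 𝕜 m 0 := ((hXa b).mul (hwa b')).sub ((hXa b').mul (hwa b))
  have hm0 : m 0 ≠ 0 := hm
  have hmne := hma.continuousAt.eventually_ne hm0
  -- Cramer's rule for `U = p * X + q * w`, using a minor that is nonzero at `0`; thus `p` and `q`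
  -- are analytic.
  set p : 𝕜 → 𝕜 := (U b * w b' - U b' * w b) / m with hpdef
  set q : 𝕜 → 𝕜 := (X b * U b' - X b' * U b) / m with hqdef
  have hp : AnalyticAt 𝕜 p 0 := (((hU b).mul (hwa b')).sub ((hU b').mul (hwa b))).div hma hm0
  have hq : AnalyticAt 𝕜 q 0 := (((hXa b).mul (hU b')).sub ((hXa b').mul (hU b))).div hma hm0
  have hf : ∀ᶠ t in 𝓝[≠] (0 : 𝕜), f t = p t * (X a t * f t + w a t * g t) := by
    filter_upwards [hF, hmne.filter_mono nhdsWithin_le_nhds] with t h1 h2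
    have e1 := h1.2 b
    have e2 := h1.2 b'
    simp only [hpdef, Pi.div_apply, Pi.sub_apply, Pi.mul_apply]
    rw [div_mul_eq_mul_div, eq_div_iff h2]
    simp only [hmdef, Pi.sub_apply, Pi.mul_apply]
    linear_combination w b' t * e1 - w b t * e2
  have hg : ∀ᶠ t in 𝓝[≠] (0 : 𝕜), g t = q t * (X a t * f t + w a t * g t) := by
    filter_upwards [hF, hmne.filter_mono nhdsWithin_le_nhds] with t h1 h2
    have e1 := h1.2 b
    have e2 := h1.2 b'
    simp only [hqdef, Pi.div_apply, Pi.sub_apply, Pi.mul_apply]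
    rw [div_mul_eq_mul_div, eq_div_iff h2]
    simp only [hmdef, Pi.sub_apply, Pi.mul_apply]
    linear_combination X b t * e2 - X b' t * e1
  have hUe : ∀ᶠ t in 𝓝 (0 : 𝕜), ∀ b, U b t = p t * X b t + q t * w b t := by
    refine eventually_all.2 fun b => ?_
    have hc : AnalyticAt 𝕜 (p * X b + q * w b) 0 := (hp.mul (hXa b)).add (hq.mul (hwa b))
    -- The velocity gives the identity only for `t ≠ 0`; continuity carries it to `0`, which puts
    -- the limit line in the plane.
    refine ((hU b).continuousAt.eventuallyEq_nhds_iff_eventuallyEq_nhdsNE hc.continuousAt).1 ?_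
    filter_upwards [hF, hf, hg] with t h1 h2 h3
    refine mul_left_cancel₀ h1.1 ?_
    rw [← h1.2 b, Pi.add_apply, Pi.mul_apply, Pi.mul_apply]
    linear_combination X b t * h2 + w b t * h3
  have hUae : ∀ᶠ t in 𝓝 (0 : 𝕜), U a t = 1 := Eventually.of_forall hUa
  refine ⟨⟨p 0, q 0, hUe.self_of_nhds⟩, ?_⟩
  -- If the line is spanned by `w` at `0`, the roles of `X` and `w` are exchanged; `p` and `q`
  -- cannot both vanish there since `U a = 1`.
  by_cases hp0 : p 0 = 0
  · have hq0 : q 0 ≠ 0 := fun hq0 => by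
      have := hUe.self_of_nhds a
      rw [hUa, hp0, hq0] at this
      simp at this
    obtain ⟨R', f', g', X', w', h1, h2⟩ := h.swap.exists_prolonged_of_ne hq hp hq0
      (hg.mono fun t ht => ht.trans (by rw [add_comm]))
      (hf.mono fun t ht => ht.trans (by rw [add_comm]))
      (hUe.mono fun t ht b => (ht b).trans (add_comm _ _)) hUae
    exact ⟨R', f', g', X', w', h1, h2.left_self, h2.right_self,
      fun b hb0 hb => h2.right_ne b hb0 hb.symm,
      h2.coeff_self.mono fun t ht => ht.trans (add_comm _ _), h2.coeff_ne⟩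
  · exact h.exists_prolonged_of_ne hp hq hp0 hf hg hUe hUae

/-! ### The tangent plane field of a surface along a curve -/

theorem exists_minor_ne_zero {ι : Type*} (x w : ι → 𝕜)
    (h : ∀ s r : 𝕜, (∀ b, s * x b + r * w b = 0) → s = 0 ∧ r = 0) :
    ∃ b b', x b * w b' - x b' * w b ≠ 0 := by
  by_contra! hall
  have h1 : ∀ b, x b = 0 ∧ w b = 0 := fun b => by
    obtain ⟨h2, h3⟩ := h (-w b) (x b) fun b' => by linear_combination hall b b'
    exact ⟨h3, neg_eq_zero.1 h2⟩
  exact one_ne_zero (h 1 0 fun b => by rw [(h1 b).1, (h1 b).2]; ring).1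

/-- Chain rule: the coefficients are the two partial derivatives of `H` along `τ`. This is the ring
that starts the induction. -/
theorem isDifferentialRing_comp {τ : 𝕜 → 𝕜 × 𝕜} (hτ : AnalyticAt 𝕜 τ 0) :
    IsDifferentialRing {h | ∃ H : 𝕜 × 𝕜 → 𝕜, AnalyticAt 𝕜 H (τ 0) ∧ h = H ∘ τ}
      (fun t => (deriv τ t).1) (fun t => (deriv τ t).2) where
  analyticAt := by
    rintro _ ⟨H, hH, rfl⟩
    exact hH.comp hτ
  const_mem z := ⟨fun _ => z, analyticAt_const, rfl⟩
  add_mem := by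
    rintro _ ⟨H, hH, rfl⟩ _ ⟨H', hH', rfl⟩
    exact ⟨H + H', hH.add hH', rfl⟩
  mul_mem := by
    rintro _ ⟨H, hH, rfl⟩ _ ⟨H', hH', rfl⟩
    exact ⟨H * H', hH.mul hH', rfl⟩
  inv_mem := by
    rintro _ ⟨H, hH, rfl⟩ h0
    exact ⟨H⁻¹, hH.inv h0, rfl⟩
  deriv_eq := by
    rintro _ ⟨H, hH, rfl⟩
    have hD : ∀ v : 𝕜 × 𝕜, AnalyticAt 𝕜 (fun z => fderiv 𝕜 H z v) (τ 0) := fun v =>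
      ((ContinuousLinearMap.apply 𝕜 𝕜 v).analyticAt _).comp hH.fderiv
    refine ⟨_, ⟨_, hD (1, 0), rfl⟩, _, ⟨_, hD (0, 1), rfl⟩, ?_⟩
    have h1 : ∀ᶠ t in 𝓝 (0 : 𝕜), AnalyticAt 𝕜 H (τ t) :=
      hτ.continuousAt.eventually hH.eventually_analyticAt
    refine Eventually.filter_mono nhdsWithin_le_nhds ?_
    filter_upwards [h1, hτ.eventually_analyticAt] with t h2 h3
    rw [(h2.differentiableAt.hasFDerivAt.comp_hasDerivAt t
      h3.differentiableAt.hasDerivAt).deriv]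
    have h4 : deriv τ t = (deriv τ t).1 • ((1 : 𝕜), (0 : 𝕜)) + (deriv τ t).2 • ((0 : 𝕜), (1 : 𝕜)) := by
      ext <;> simp
    rw [h4, map_add, map_smul, map_smul]
    simp [mul_comm]

theorem LiesInDim.mono {γ : 𝕜 → (Fin (n + 1) → 𝕜)} {d d' : ℕ} (h : LiesInDim γ d) (hd : d ≤ d') :
    LiesInDim γ d' := by
  obtain ⟨φ, h1, h2, h3⟩ := h
  exact ⟨φ, h1, h2, h3.mono fun t ht j hj => ht j (hd.trans hj)⟩

theorem IsPlanar.liesInDim {γ : 𝕜 → (Fin (n + 1) → 𝕜)} (h : IsPlanar γ) : LiesInDim γ 2 := by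
  -- The infimum of an empty set of naturals would be 0, so it must be checked that it is attained;
  -- the ambient dimension is always admissible.
  have hne : {d | LiesInDim γ d}.Nonempty := by
    refine ⟨n + 1, id, analyticAt_id, ?_, Eventually.of_forall fun t j hj => ?_⟩
    · rw [fderiv_id]
      exact Function.bijective_id
    · exact absurd j.isLt hj.not_gt
  exact LiesInDim.mono (Nat.sInf_mem hne) h.2

/-- The local inverse of `φ`, restricted to the first two coordinates, parametrises a surface by
`Ψ`, and the curve is `Ψ ∘ τ`. The plane field is spanned by the partial derivatives of `Ψ` along
`τ`. A second coordinate exists because `n ≠ 0`. -/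
theorem exists_planeField_deriv {γ : 𝕜 → (Fin (n + 1) → 𝕜)} (hγ : AnalyticAt 𝕜 γ 0)
    (h : LiesInDim γ 2) (hn : n ≠ 0) :
    ∃ R f g, ∃ X w : Fin (n + 1) → 𝕜 → 𝕜, IsPlaneField R f g X w ∧
      ∀ᶠ t in 𝓝[≠] (0 : 𝕜), deriv γ t = fun b => X b t * f t + w b t * g t := by
  obtain ⟨φ, hφ, hbij, hz⟩ := h
  set e : (Fin (n + 1) → 𝕜) ≃L[𝕜] (Fin (n + 1) → 𝕜) :=
    (LinearEquiv.ofBijective (fderiv 𝕜 φ (γ 0)).toLinearMap hbij).toContinuousLinearEquiv with he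
  have hφ' : HasFDerivAt φ (e : (Fin (n + 1) → 𝕜) →L[𝕜] (Fin (n + 1) → 𝕜)) (γ 0) := by
    have h1 : (e : (Fin (n + 1) → 𝕜) →L[𝕜] (Fin (n + 1) → 𝕜)) = fderiv 𝕜 φ (γ 0) := by
      ext1 v; rfl
    rw [h1]
    exact hφ.differentiableAt.hasFDerivAt
  have hω : (⊤ : WithTop ℕ∞) ≠ 0 := by simp
  have hc : ContDiffAt 𝕜 ⊤ φ (γ 0) := hφ.contDiffAt
  have hs := hc.hasStrictFDerivAt' hφ' hω
  set ψ := hc.localInverse hφ' hω with hψdef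
  have hψ : AnalyticAt 𝕜 ψ (φ (γ 0)) := (hc.to_localInverse hφ' hω).analyticAt
  have hψ' : HasFDerivAt ψ (e.symm : (Fin (n + 1) → 𝕜) →L[𝕜] (Fin (n + 1) → 𝕜)) (φ (γ 0)) :=
    hs.to_localInverse.hasFDerivAt
  have hψφ : ∀ᶠ t in 𝓝 (0 : 𝕜), ψ (φ (γ t)) = γ t :=
    hγ.continuousAt.eventually hs.eventually_left_inverse
  have h01 : (0 : Fin (n + 1)) ≠ ⟨1, by omega⟩ := by simp [Fin.ext_iff]
  set i₁ : Fin (n + 1) := ⟨1, by omega⟩ with hi₁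
  set ι : 𝕜 × 𝕜 →L[𝕜] (Fin (n + 1) → 𝕜) :=
    (ContinuousLinearMap.fst 𝕜 𝕜 𝕜).smulRight (Pi.single 0 1) +
    (ContinuousLinearMap.snd 𝕜 𝕜 𝕜).smulRight (Pi.single i₁ 1) with hι
  have hιz : ∀ z : 𝕜 × 𝕜, ι z 0 = z.1 ∧ ι z i₁ = z.2 ∧ ∀ j : Fin (n + 1), 2 ≤ (j : ℕ) → ι z j = 0 := by
    intro z
    refine ⟨by simp [hι, h01], by simp [hι, h01.symm], fun j hj => ?_⟩
    have h0 : j ≠ 0 := by rintro rfl; simp at hj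
    have h1 : j ≠ i₁ := by rintro rfl; simp [hi₁] at hj
    simp [hι, h0, h1]
  set τ : 𝕜 → 𝕜 × 𝕜 := fun t => (φ (γ t) 0, φ (γ t) i₁) with hτdef
  have hφγ : AnalyticAt 𝕜 (fun t => φ (γ t)) 0 := hφ.comp hγ
  have hcoord : ∀ j, AnalyticAt 𝕜 (fun t => φ (γ t) j) 0 := fun j =>
    ((ContinuousLinearMap.proj (R := 𝕜) (φ := fun _ : Fin (n + 1) => 𝕜) j).analyticAt _).comp hφγ
  have hτ : AnalyticAt 𝕜 τ 0 := (hcoord 0).prod (hcoord i₁)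
  have hιτ : ∀ᶠ t in 𝓝 (0 : 𝕜), ι (τ t) = φ (γ t) := by
    filter_upwards [hz] with t ht
    funext j
    obtain ⟨h0, h1, h2⟩ := hιz (τ t)
    by_cases hj0 : j = 0
    · rw [hj0, h0]
    by_cases hj1 : j = i₁
    · rw [hj1, h1]
    have hj : 2 ≤ (j : ℕ) := by
      simp only [hi₁, Fin.ext_iff, Fin.val_zero] at hj0 hj1
      omega
    rw [h2 j hj, ht j hj]
  have hιτ0 := hιτ.self_of_nhds
  rw [← hιτ0] at hψ hψ'
  set Ψ : 𝕜 × 𝕜 → (Fin (n + 1) → 𝕜) := fun z => ψ (ι z) with hΨdef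
  have hΨ : AnalyticAt 𝕜 Ψ (τ 0) := AnalyticAt.comp (g := ψ) hψ (ι.analyticAt _)
  have hΨ' : fderiv 𝕜 Ψ (τ 0) =
      (e.symm : (Fin (n + 1) → 𝕜) →L[𝕜] (Fin (n + 1) → 𝕜)).comp ι :=
    (HasFDerivAt.comp (g := ψ) _ hψ' ι.hasFDerivAt).fderiv
  have hγΨ : γ =ᶠ[𝓝 0] Ψ ∘ τ := by
    filter_upwards [hιτ, hψφ] with t h1 h2
    simp only [hΨdef, Function.comp_apply]
    rw [h1, h2]
  have hD : ∀ (v : 𝕜 × 𝕜) (b : Fin (n + 1)),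
      AnalyticAt 𝕜 (fun z => fderiv 𝕜 Ψ z v b) (τ 0) := fun v b =>
    (((ContinuousLinearMap.proj (R := 𝕜) (φ := fun _ : Fin (n + 1) => 𝕜) b).comp
      (ContinuousLinearMap.apply 𝕜 (Fin (n + 1) → 𝕜) v)).analyticAt _).comp hΨ.fderiv
  refine ⟨_, _, _, fun b t => fderiv 𝕜 Ψ (τ t) (1, 0) b, fun b t => fderiv 𝕜 Ψ (τ t) (0, 1) b,
    ⟨isDifferentialRing_comp hτ, fun b => ⟨_, hD (1, 0) b, rfl⟩, fun b => ⟨_, hD (0, 1) b, rfl⟩,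
      exists_minor_ne_zero _ _ fun s r hsr => ?_⟩, ?_⟩
  · have h1 : fderiv 𝕜 Ψ (τ 0) (s, r) = 0 := by
      have h2 : ((s, r) : 𝕜 × 𝕜) = s • ((1 : 𝕜), (0 : 𝕜)) + r • ((0 : 𝕜), (1 : 𝕜)) := by
        ext <;> simp
      rw [h2, map_add, map_smul, map_smul]
      funext b
      exact hsr b
    rw [hΨ', ContinuousLinearMap.comp_apply] at h1
    have h3 : ι (s, r) = 0 := e.symm.injective (h1.trans (map_zero e.symm).symm)
    obtain ⟨h4, h5, -⟩ := hιz (s, r)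
    rw [h3] at h4 h5
    exact ⟨h4.symm, h5.symm⟩
  · refine Eventually.filter_mono nhdsWithin_le_nhds ?_
    filter_upwards [hγΨ.eventually_nhds, hτ.eventually_analyticAt,
      hτ.continuousAt.eventually hΨ.eventually_analyticAt] with t h1 h2 h3
    rw [EventuallyEq.deriv_eq h1, (h3.differentiableAt.hasFDerivAt.comp_hasDerivAt t
      h2.differentiableAt.hasDerivAt).deriv]
    have h4 : deriv τ t = (deriv τ t).1 • ((1 : 𝕜), (0 : 𝕜)) + (deriv τ t).2 • ((0 : 𝕜), (1 : 𝕜)) := by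
      ext <;> simp
    conv_lhs => rw [h4, map_add, map_smul, map_smul]
    funext b
    simp [mul_comm]

/-! ### Prolonging curves in charts -/

theorem completeSpace_coord : ∀ k : ℕ, CompleteSpace (Coord 𝕜 n k)
  | 0 => inferInstanceAs (CompleteSpace (Fin (n + 1) → 𝕜))
  | k + 1 =>
    have := completeSpace_coord k
    inferInstanceAs (CompleteSpace (Coord 𝕜 n k × (Fin n → 𝕜)))

theorem analyticAt_homCoord {σ : 𝕜 → Coord 𝕜 n (k + 1)} (hσ : AnalyticAt 𝕜 σ 0)
    (a b : Fin (n + 1)) : AnalyticAt 𝕜 (fun t => homCoord a (σ t) b) 0 := by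
  refine Fin.succAboveCases a ?_ (fun m => ?_) b
  · simp only [homCoord_self]
    exact analyticAt_const
  · simp only [homCoord_succAbove]
    exact (((ContinuousLinearMap.proj (R := 𝕜) (φ := fun _ : Fin n => 𝕜) m).comp
      Coord.fib).analyticAt _).comp hσ

/-- The velocity of a curve is proportional to the vector with the homogeneous coordinates of its
prolongation. -/
theorem eq_mul_homCoord {c : Chart n k} {a : Fin (n + 1)} {x : Coord 𝕜 n (k + 1)}
    {v : Fin (n + 1) → 𝕜} (hv : frameVector c (Coord.proj x) v ≠ 0)
    (hl : chartLine c a x = Submodule.span 𝕜 {frameVector c (Coord.proj x) v}) :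
    v a ≠ 0 ∧ ∀ b, v b = v a * homCoord a x b := by
  have h1 : frameVector c (Coord.proj x) v ∈ chartLine c a x :=
    hl ▸ Submodule.mem_span_singleton_self _
  obtain ⟨z, hz⟩ := Submodule.mem_span_singleton.1 h1
  rw [affineVector_frame, smul_frameVector] at hz
  have h2 : z • homCoord a x = v := frameVector_injective _ _ hz
  have h3 : v a = z := by rw [← h2, Pi.smul_apply, homCoord_self, smul_eq_mul, mul_one]
  refine ⟨fun h0 => hv ?_, fun b => by rw [h3, ← h2]; rfl⟩
  rw [← h2, ← h3, h0, zero_smul, frameVector_zero]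

/-- The projection of the velocity is the velocity below, which fixes the coefficient at `a`; the
fibre part gives the other coefficients as derivatives of the affine coordinates. -/
theorem deriv_eq_frameVector {c : Chart n k} {a : Fin (n + 1)} {s : 𝕜 → Coord 𝕜 n k}
    {σ : 𝕜 → Coord 𝕜 n (k + 1)} {t : 𝕜} {v v' : Fin (n + 1) → 𝕜}
    (hσ : DifferentiableAt 𝕜 σ t) (hs : ∀ᶠ t in 𝓝 t, Coord.proj (σ t) = s t)
    (hv : deriv s t = frameVector c (s t) v) (hva : ∀ b, v b = v a * homCoord a (σ t) b)
    (hv'a : v' a = v a)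
    (hv' : ∀ b, b ≠ a → v' b = deriv (fun t => homCoord a (σ t) b) t) :
    deriv σ t = frameVector (c.snoc a) (σ t) v' := by
  have h1 : Coord.proj (deriv σ t) = Coord.proj (frameVector (c.snoc a) (σ t) v') := by
    have h2 : HasDerivAt (fun t => Coord.proj (σ t)) (Coord.proj (deriv σ t)) t :=
      (Coord.proj : Coord 𝕜 n (k + 1) →L[𝕜] Coord 𝕜 n k).hasFDerivAt.comp_hasDerivAt t hσ.hasDerivAt
    have h3 : deriv (fun t => Coord.proj (σ t)) t = deriv s t := EventuallyEq.deriv_eq hs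
    rw [← h2.deriv, h3, hv, proj_frameVector, affineVector_frame, smul_frameVector, hs.self_of_nhds,
      hv'a]
    congr 1
    funext b
    exact hva b
  have h4 : Coord.fib (deriv σ t) = Coord.fib (frameVector (c.snoc a) (σ t) v') := by
    funext m
    rw [fib_frameVector, hv' _ (Fin.succAbove_ne a m)]
    simp only [homCoord_succAbove]
    have h5 : HasDerivAt (fun t => Coord.fib (σ t) m) (Coord.fib (deriv σ t) m) t :=
      ((ContinuousLinearMap.proj (R := 𝕜) (φ := fun _ : Fin n => 𝕜) m).comp
        Coord.fib).hasFDerivAt.comp_hasDerivAt t hσ.hasDerivAt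
    exact h5.deriv.symm
  exact Prod.ext h1 h4

/-- Along the prolongation of a planar curve there is a field of planes in the distribution which
contains the velocities. At `0`, the second vector of its basis is vertical, and it lies in no
critical hyperplane originating from a lower level; therefore no vertical tangent line of the curve
lies in such a hyperplane. -/
theorem exists_planeField_prolongation {γ : 𝕜 → (Fin (n + 1) → 𝕜)} (hγ : AnalyticAt 𝕜 γ 0)
    (h : LiesInDim γ 2) (hn : n ≠ 0) (c : Chart n k) (σ : 𝕜 → Coord 𝕜 n k)
    (hσ : IsProlongation γ c σ) :
    ∃ R f g, ∃ X w : Fin (n + 1) → 𝕜 → 𝕜, IsPlaneField R f g X w ∧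
      (∀ᶠ t in 𝓝[≠] (0 : 𝕜),
        deriv σ t = frameVector c (σ t) fun b => X b t * f t + w b t * g t) ∧
      (∀ b, Avoids k b c (σ 0) → X b 0 ≠ 0 ∧ w b 0 = 0) ∧
      (∀ i b, i < k → Avoids i b c (σ 0) → w b 0 ≠ 0) ∧
      ∀ i j b b', i < j → j < k → Avoids i b c (σ 0) → ¬ Avoids j b' c (σ 0) := by
  induction c with
  | base =>
    obtain ⟨R, f, g, X, w, h1, h2⟩ := exists_planeField_deriv hγ h hn
    refine ⟨R, f, g, X, w, h1, ?_, fun _ h => h.elim, fun _ _ _ h => h.elim,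
      fun _ _ _ _ _ _ h => h.elim⟩
    have h3 : ∀ᶠ t in 𝓝[≠] (0 : 𝕜), σ =ᶠ[𝓝 t] γ :=
      (Eventually.eventually_nhds hσ).filter_mono nhdsWithin_le_nhds
    filter_upwards [h2, h3] with t h4 h5
    rw [frameVector_base, ← h4]
    exact h5.deriv_eq
  | @snoc k c a ih =>
    have := completeSpace_coord (𝕜 := 𝕜) (n := n) (k + 1)
    obtain ⟨s, hs, hσa, hproj, hline⟩ := hσ
    obtain ⟨R, f, g, X, w, hP, hder, hk, hlt, hno⟩ := ih s hs
    have hs0 : Coord.proj (σ 0) = s 0 := hproj.self_of_nhds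
    have hF : ∀ᶠ t in 𝓝[≠] (0 : 𝕜), X a t * f t + w a t * g t ≠ 0 ∧ ∀ b,
        X b t * f t + w b t * g t = (X a t * f t + w a t * g t) * homCoord a (σ t) b := by
      filter_upwards [hder, hline, hproj.filter_mono nhdsWithin_le_nhds] with t h1 h2 h3
      rw [h1, ← h3] at h2
      exact eq_mul_homCoord h2.1 h2.2
    obtain ⟨⟨α, β, hαβ⟩, R', f', g', X', w', hP', hX'⟩ :=
      hP.exists_prolonged (U := fun b t => homCoord a (σ t) b)
        (analyticAt_homCoord hσa a) (fun t => homCoord_self a (σ t)) hF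
    have hlow : ∀ {i b}, i < k + 1 → Avoids i b (c.snoc a) (σ 0) →
        Avoids i b c (s 0) ∧ homCoord a (σ 0) b = 0 := by
      intro i b hi hA
      rw [← hs0]
      exact (avoids_snoc hi.ne).1 hA
    refine ⟨R', f', g', X', w', hP', ?_, ?_, ?_, ?_⟩
    · filter_upwards [hder, hF, hX'.coeff_self, hX'.coeff_ne,
        (hσa.eventually_analyticAt.mono fun _ h => h.differentiableAt).filter_mono
          nhdsWithin_le_nhds,
        hproj.eventually_nhds.filter_mono nhdsWithin_le_nhds] with t h1 h2 h3 h4 h5 h6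
      exact deriv_eq_frameVector h5 h6 h1 h2.2 h3 h4
    · intro b hb
      rw [(avoids_top rfl).1 hb, hX'.left_self, hX'.right_self]
      exact ⟨one_ne_zero, rfl⟩
    · intro i b hi hA
      obtain ⟨h1, h2⟩ := hlow hi hA
      -- The old plane is not contained in the hyperplane: `w` witnesses this for `i < k`, and `X`
      -- for `i = k`, where the hyperplane is vertical.
      refine hX'.right_ne b h2 ?_
      rcases h1.le.lt_or_eq with h3 | rfl
      · exact Or.inr (hlt i b h3 h1)
      · exact Or.inl (hk b h1).1
    · intro i j b b' hij hj hA hA'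
      obtain ⟨h1, h2⟩ := hlow (hij.trans hj) hA
      obtain ⟨h3, h4⟩ := hlow hj hA'
      -- For `j < k` the two conditions already clash one level down. For `j = k` the line is `α X +
      -- β w`; lying in the vertical hyperplane forces `α = 0`, lying in the one from level `i` then
      -- forces `β = 0`, but the line is nonzero.
      rcases h3.le.lt_or_eq with h5 | rfl
      · exact hno i j b b' hij h5 h1 h3
      · have e1 := hαβ b'
        rw [h4, (hk b' h3).2, mul_zero, add_zero] at e1
        have hα : α = 0 := (mul_eq_zero.1 e1.symm).resolve_right (hk b' h3).1
        have e2 := hαβ b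
        rw [h2, hα, zero_mul, zero_add] at e2
        have hβ : β = 0 := (mul_eq_zero.1 e2.symm).resolve_right (hlt i b hij h1)
        have e3 := hαβ a
        rw [homCoord_self, hα, hβ, zero_mul, zero_mul, add_zero] at e3
        exact one_ne_zero e3

/-! ### Points reached by planar curves -/

theorem Touches.below {γ : 𝕜 → (Fin (n + 1) → 𝕜)} {q : Point 𝕜 n (k + 1)} (h : Touches γ q) :
    Touches γ (Point.below q) := by
  obtain ⟨σ, ⟨s, hs, -, hproj, -⟩, h0⟩ := h
  refine ⟨s, hs, ?_⟩
  rw [← hproj.self_of_nhds, h0]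
  rfl

theorem Touches.proj {γ : 𝕜 → (Fin (n + 1) → 𝕜)} :
    ∀ (j : ℕ) {q : Point 𝕜 n (k + j)}, Touches γ q → Touches γ (Point.proj j q)
  | 0, _, h => h
  | j + 1, _, h => Touches.proj j (Touches.below (k := k + j) h)

theorem IsPlanar.not_touches_mk {γ : 𝕜 → (Fin (n + 1) → 𝕜)} (hγ : IsPlanar γ) (p : Point 𝕜 n k)
    (l : Line p) {H₁ H₂ : Submodule 𝕜 (Coord 𝕜 n k)} (h₁ : IsCritical p H₁) (h₂ : IsCritical p H₂)
    (hne : H₁ ≠ H₂) (hl : l.1 ≤ H₁ ⊓ H₂) : ¬ Touches γ (Point.mk p l) := by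
  rintro ⟨σ, hσ, h0⟩
  obtain ⟨i, hi, rfl⟩ := h₁
  obtain ⟨j, hj, rfl⟩ := h₂
  obtain ⟨hik, b, hb⟩ := exists_avoids i p l hi (hl.trans inf_le_left)
  obtain ⟨hjk, b', hb'⟩ := exists_avoids j p l hj (hl.trans inf_le_right)
  have hij : i ≠ j := by rintro rfl; exact hne rfl
  -- For `n = 0` the only homogeneous coordinate is the normalised one, so no line is critical.
  have hn : n ≠ 0 := by
    rintro rfl
    have h1 := ((avoids_snoc hik.ne).1 hb).2
    rw [show b = _ from Fin.ext (by omega), homCoord_self] at h1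
    exact one_ne_zero h1
  rw [← h0] at hb hb'
  obtain ⟨R, f, g, X, w, -, -, -, -, hno⟩ :=
    exists_planeField_prolongation hγ.1.1 hγ.liesInDim hn _ σ hσ
  rcases hij.lt_or_gt with h | h
  · exact hno i j b b' h hjk hb hb'
  · exact hno j i b' b h hik hb' hb

theorem exists_critical_of_letter_eq {p : Point 𝕜 n k} {l : Line p}
    (h : letter p l = Letter.L) : ∃ H₁ H₂ : Submodule 𝕜 (Coord 𝕜 n k),
      IsCritical p H₁ ∧ IsCritical p H₂ ∧ H₁ ≠ H₂ ∧ l.1 ≤ H₁ ⊓ H₂ := by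
  unfold letter at h
  split_ifs at h with h1 h2
  obtain ⟨H, hH, hne, hl⟩ := h2
  cases k with
  | zero =>
    -- The vertical space at level 0 is zero by convention, so it contains no line.
    have h3 : l.1 = ⊥ := le_bot_iff.1 h1
    have h4 := l.2.2
    rw [h3, finrank_bot] at h4
    exact absurd h4 zero_ne_one
  | succ k => exact ⟨H, vertical p, hH, isCritical_vertical p, hne, le_inf hl h1⟩

theorem IsPlanar.not_touches_of_mem_code {γ : 𝕜 → (Fin (n + 1) → 𝕜)} (hγ : IsPlanar γ) :
    ∀ {k : ℕ} (q : Point 𝕜 n k), Letter.L ∈ code q → ¬ Touches γ q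
  | 0, _, h => by simp [code] at h
  | k + 1, q, h => by
    intro ht
    rcases List.mem_append.1 h with h1 | h1
    · exact hγ.not_touches_of_mem_code (Point.below q) h1 ht.below
    · obtain ⟨H₁, H₂, h₁, h₂, hne, hl⟩ :=
        exists_critical_of_letter_eq (List.mem_singleton.1 h1).symm
      exact hγ.not_touches_mk (Point.below q) (Point.line q) h₁ h₂ hne hl ht

end

end Monster

theorem mainTheorem7 {𝕜 : Type*} [RCLike 𝕜] (n : ℕ) :
    (∀ (k : ℕ) (p : Monster.Point 𝕜 n k) (l : Monster.Line p)
      (H₁ H₂ : Submodule 𝕜 (Monster.Coord 𝕜 n k)),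
      Monster.IsCritical p H₁ → Monster.IsCritical p H₂ → H₁ ≠ H₂ → l.1 ≤ H₁ ⊓ H₂ →
      (∀ γ : 𝕜 → (Fin (n + 1) → 𝕜), Monster.IsPlanar γ →
        ¬ Monster.Touches γ (Monster.Point.mk p l)) ∧
      ∀ (j : ℕ) (q : Monster.Point 𝕜 n (k + 1 + j)),
        Monster.Point.proj j q = Monster.Point.mk p l →
        ∀ γ : 𝕜 → (Fin (n + 1) → 𝕜), Monster.IsPlanar γ → ¬ Monster.Touches γ q) ∧
    ∀ (k : ℕ) (w : List Monster.Letter), Monster.Letter.L ∈ w →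
      ∀ q ∈ Monster.codeClass 𝕜 n k w,
        (∀ γ : 𝕜 → (Fin (n + 1) → 𝕜), Monster.IsPlanar γ → ¬ Monster.Touches γ q) ∧
        ¬ Monster.IsPlanarPoint q := by
  refine ⟨fun k p l H₁ H₂ h₁ h₂ hne hl => ?_, fun k w hw q hq => ?_⟩
  · have h : ∀ γ : 𝕜 → (Fin (n + 1) → 𝕜), Monster.IsPlanar γ →
        ¬ Monster.Touches γ (Monster.Point.mk p l) :=
      fun γ hγ => hγ.not_touches_mk p l h₁ h₂ hne hl
    exact ⟨h, fun j q hq γ hγ ht => h γ hγ (hq ▸ ht.proj j)⟩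
  · have hL : Monster.Letter.L ∈ Monster.code q := by
      rw [show Monster.code q = w from hq]
      exact hw
    refine ⟨fun γ hγ => hγ.not_touches_of_mem_code q hL, ?_⟩
    rintro ⟨-, γ, ⟨hγ, σ, hσ, h0, -⟩, hd⟩
    exact Monster.IsPlanar.not_touches_of_mem_code ⟨hγ, hd.le⟩ q hL ⟨σ, hσ, h0⟩
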